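/- For a finite group $G$, let $R(G)$ be the ring of virtual complex characters of $G$, let $\lambda^n$ be the operations on $R(G)$ induced by exterior powers, let $\gamma^n(x)=\lambda^n(x+n-1)$, let $I$ be the kernel of the degree map $R(G)\to\mathbb{Z}$, and let $\Gamma^n(G)$ be the subgroup of $R(G)$ generated by the monomials $\gamma^{n_1}(x_1)\cdots\gamma^{n_k}(x_k)$ with $x_i\in I$ and $\sum_i n_i\ge n$ (the Grothendieck filtration). For $H\le G$, let $\mathcal{N}_H^G$ denote tensor induction, extended to $R(H)$ as follows. For a representation $W$ of $H$ and $C\subseteq G/H$, let $\chi(W)_C=\bigotimes_{c\in C}W_c$, where $W_c=c\otimes W\subseteq\mathrm{Ind}_H^G W$; this is a representation of the stabilizer of $C$. Thus $\chi(W)$ is a $G$-equivariant vector bundle on the set of subsets of $G/H$. For virtual bundles $z,t$ on this $G$-set let $(z\vee t)_C=\bigoplus_{C_1\sqcup C_2=C}z_{C_1}\otimes t_{C_2}$. Then $\mathcal{N}_H^G(\sigma-\tau)=(\chi(\sigma)\vee b)_{G/H}$ for representations $\sigma,\tau$ of $H$, where $b$ is the inverse of $\chi(\tau)$ for $\vee$.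 In particular $\mathcal{N}_H^G(\sigma)$ is the usual tensor induced representation $\bigotimes_{c\in G/H}\sigma_c$. **Theorem.** Let $G$ be a finite abelian group and let $H\le G$ be a subgroup of prime index $[G:H]=p$. Let $n\ge 0$. If $x\in\Gamma^n(H)$, then $\mathcal{N}_H^G(x)$ is well defined and lies in $\Gamma^{np}(G)$. -/

import Mathlib

open scoped TensorProduct

/-! ### Virtual characters, exterior power operations, and the Grothendieck filtration

Virtual characters are complex valued functions on the group, with pointwise addition and
multiplication; representations are finite-dimensional and complex. -/

namespace VirtualCharacter

section Filtration

variable {G : Type*} [Group G]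

theorem exists_character_eq_one : ∃ V : FDRep ℂ G, V.character = 1 := by
  refine ⟨FDRep.of (Representation.trivial ℂ G ℂ), ?_⟩
  funext g
  change LinearMap.trace ℂ ℂ (Representation.trivial ℂ G ℂ g) = 1
  have h : Representation.trivial ℂ G ℂ g = LinearMap.id := by ext; simp
  rw [h, LinearMap.trace_id]
  simp

variable (G) in
/-- The ring `R(G)` of virtual characters: the abelian group generated by the characters of
representations of `G`, with the product induced by the tensor product of representations. -/
noncomputable def ring : Subring (G → ℂ) where
  __ := AddSubgroup.closure (Set.range (FDRep.character (k := ℂ) (G := G)))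
  one_mem' := by
    obtain ⟨V, hV⟩ := exists_character_eq_one (G := G)
    exact AddSubgroup.subset_closure ⟨V, hV⟩
  mul_mem' := by
    intro x y hx hy
    change x * y ∈ AddSubgroup.closure (Set.range (FDRep.character (k := ℂ) (G := G)))
    refine AddSubgroup.closure_induction₂ (p := fun a b _ _ =>
      a * b ∈ AddSubgroup.closure (Set.range (FDRep.character (k := ℂ) (G := G))))
      ?_ ?_ ?_ ?_ ?_ ?_ ?_ hx hy
    · rintro _ _ ⟨V, rfl⟩ ⟨W, rfl⟩
      exact AddSubgroup.subset_closure
        ⟨CategoryTheory.MonoidalCategoryStruct.tensorObj V W, FDRep.char_tensor V W⟩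
    · intro a _; simp
    · intro a _; simp
    · intro a b c _ _ _ h1 h2; rw [add_mul]; exact add_mem h1 h2
    · intro a b c _ _ _ h1 h2; rw [mul_add]; exact add_mem h1 h2
    · intro a b _ _ h; rw [neg_mul]; exact neg_mem h
    · intro a b _ _ h; rw [mul_neg]; exact neg_mem h

/-- The augmentation ideal `I`, the kernel of the degree map `R(G) → ℤ`. The degree of a
character is its value at the identity. -/
def augmentationIdeal : Set (G → ℂ) := {x | x ∈ ring G ∧ x 1 = 0}

/-- The character of the `n`-th exterior power of the representation `V`. -/
noncomputable def exteriorCharacter (n : ℕ) (V : FDRep ℂ G) : G → ℂ :=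
  fun g => LinearMap.trace ℂ (⋀[ℂ]^n V) (exteriorPower.map n (V.ρ g))

/-- `λ_t(V) = ∑ λⁿ(V) tⁿ`, for a representation `V`. -/
noncomputable def lambdaSeries (V : FDRep ℂ G) : PowerSeries (G → ℂ) :=
  PowerSeries.mk fun n => exteriorCharacter n V

/-- The graph of `λⁿ` on `R(G)`: `IsLambda n x y` means `λⁿ(x) = y`. For `x = V - W` the series
`λ_t(x)` is determined by `λ_t(x) λ_t(W) = λ_t(V)`, as `λ_t(W)` has constant term `1`. -/
def IsLambda (n : ℕ) (x y : G → ℂ) : Prop :=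
  ∃ (V W : FDRep ℂ G) (s : PowerSeries (G → ℂ)),
    x = V.character - W.character ∧ s * lambdaSeries W = lambdaSeries V ∧
      y = PowerSeries.coeff n s

/-- The graph of `γⁿ` on `R(G)`, where `γⁿ(x) = λⁿ(x + n - 1)`. -/
def IsGamma (n : ℕ) (x y : G → ℂ) : Prop := IsLambda n (x + (n : G → ℂ) - 1) y

variable (G) in
/-- The `n`-th term `Γⁿ(G)` of the Grothendieck filtration: the abelian group generated by the
monomials `γ^{m₁}(x₁) ⋯ γ^{mₖ}(xₖ)` with all `xᵢ ∈ I` and `m₁ + ⋯ + mₖ ≥ n`. -/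
def gammaFiltration (n : ℕ) : AddSubgroup (G → ℂ) :=
  AddSubgroup.closure
    {y | ∃ (k : ℕ) (m : Fin k → ℕ) (x z : Fin k → (G → ℂ)),
      (∀ i, x i ∈ augmentationIdeal) ∧ (∀ i, IsGamma (m i) (x i) (z i)) ∧
        n ≤ ∑ i, m i ∧ y = ∏ i, z i}

end Filtration

/-! ### Tensor induction

A representation `W` of `H ≤ G` gives a `G`-equivariant bundle on `G ⧸ H` whose fibre over a coset
`c` is `t_c ⊗ W ⊆ Ind W`, with `t_c` the chosen representative of `c`. The fibre is identified with
`W` through `t_c ⊗ w ↦ w`; then `g` maps the fibre over `c` to the fibre over `g • c` through the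
element `t_{g • c}⁻¹ g t_c` of `H`. -/

section Norm

variable {G : Type*} [Group G] {H : Subgroup G}

/-- The element `t_{g • c}⁻¹ g t_c` of `H`. -/
noncomputable def cosetCocycle (g : G) (c : G ⧸ H) : H :=
  ⟨(g • c).out⁻¹ * (g * c.out), by
    rw [← QuotientGroup.eq]
    have h : ((g * c.out : G) : G ⧸ H) = g • ((c.out : G) : G ⧸ H) := rfl
    rw [h, QuotientGroup.out_eq', QuotientGroup.out_eq']⟩

/-- The set `C` of cosets satisfies `g • C = C`. -/
def Stabilizes (g : G) (C : Finset (G ⧸ H)) : Prop := ∀ c, g • c ∈ C ↔ c ∈ C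

/-- The action of an element `g` of the stabilizer of `C` on `⨂_{c ∈ C} W_c`: the tensor with
component `w_c` at `c` goes to the tensor with component `g w_c` at `g • c`. -/
noncomputable def tensorAction (W : FDRep ℂ H) (g : G) (C : Finset (G ⧸ H))
    (h : Stabilizes g C) : (⨂[ℂ] _ : C, W) →ₗ[ℂ] (⨂[ℂ] _ : C, W) :=
  (PiTensorProduct.reindex ℂ (fun _ : C => (W : Type))
      ((MulAction.toPerm g : Equiv.Perm (G ⧸ H)).subtypePerm h)).toLinearMap ∘ₗ
    PiTensorProduct.map (fun c : C => W.ρ (cosetCocycle g c))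

open scoped Classical in
/-- The character of the bundle `χ(W)` on the `G`-set of subsets of `G ⧸ H`. Its fibre over `C` is
`⨂_{c ∈ C} W_c`, a representation of the stabilizer of `C`. Characters of bundles on this `G`-set
are functions of `g` and `C` of which only the values with `g • C = C` matter. -/
noncomputable def chi (W : FDRep ℂ H) (g : G) (C : Finset (G ⧸ H)) : ℂ :=
  if h : Stabilizes g C then LinearMap.trace ℂ (⨂[ℂ] _ : C, W) (tensorAction W g C h) else 0

open scoped Classical in
/-- The product `z ∨ t = m_*(p₁^* z · p₂^* t)`, where `p₁`, `p₂`, `m` send a pair `(C₁, C₂)` of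
disjoint subsets of `G ⧸ H` to `C₁`, `C₂`, `C₁ ⊔ C₂`. The fibre of `z ∨ t` over `C` is
`⨁ z_{C₁} ⊗ t_{C₂}` over all `C₁ ⊔ C₂ = C`, and an element `g` of the stabilizer of `C` permutes the
summands, so that its trace is the sum over the pairs that are fixed by `g`. -/
noncomputable def vee (z t : G → Finset (G ⧸ H) → ℂ) (g : G) (C : Finset (G ⧸ H)) : ℂ :=
  ∑ D ∈ C.powerset with Stabilizes g D, z g D * t g (C \ D)

open scoped Classical in
/-- The unit of `∨`: the trivial line over the empty set, and zero over the other sets. -/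
noncomputable def veeOne (_ : G) (C : Finset (G ⧸ H)) : ℂ := if C = ∅ then 1 else 0

/-- The graph of the norm (tensor induction) `N_H^G` on `R(H)`: `IsNorm x y` means `N_H^G(x) = y`.
The morphism `χ` from representations under `⊕` to characters of bundles under `∨` is extended to
virtual characters by `χ(σ - τ) = χ(σ) ∨ χ(-τ)`, with `χ(-τ) = b` the inverse of `χ(τ)` for `∨`,
and `N_H^G(x)` is the fibre of `χ(x)` over the full set `G ⧸ H`. For `τ = 0` this is
the character of the tensor induced representation `⨂_{c ∈ G ⧸ H} σ_c`. -/
def IsNorm [Fintype (G ⧸ H)] (x : H → ℂ) (y : G → ℂ) : Prop :=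
  ∃ (σ τ : FDRep ℂ H) (b : G → Finset (G ⧸ H) → ℂ),
    x = σ.character - τ.character ∧
      (∀ g C, Stabilizes g C → vee (chi τ) b g C = veeOne g C) ∧
        ∀ g, y g = vee (chi σ) b g Finset.univ

end Norm

end VirtualCharacter

/-!
Representations of a finite abelian group `A` are sums of linear characters, so that `R(A)` is the
additive span of the linear characters and `I` that of the differences `χ - 1`. As
`γ_t(χ - 1) = 1 + (χ - 1) t`, the coefficient of `t ^ m` in
`γ_t(∑ χᵢ - ∑ ψⱼ) = ∏ (1 + (χᵢ - 1) t) / ∏ (1 + (ψⱼ - 1) t)` lies in `I ^ m`, and the Grothendieck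
filtration is the filtration by the powers of `I` (`gammaFiltration_le_augmentationPower`,
`augmentationPower_le_gammaFiltration`). The passage between `λ_t` and `γ_t` is the substitution
`t ↦ t / (1 + t)` (`coeff_eq_of_mul_one_add_X_eq`).

For `H` of prime index `p`, an element of `H` fixes all cosets and an element outside `H` permutes
them cyclically. Computing traces gives `N(x)(g) = x(g) ^ p` for `g ∈ H` and `N(x)(g) = x(g ^ p)` for
`g ∉ H` (`IsNorm.eq_normFun`, `isNorm_normFun`), so that `N(x)` depends only on `x` and is
multiplicative in `x`.

If a linear character `ψ` of `G` extends `χ`, then `N(χ - 1) = ∏ (ψ - ε)` over the `p` linear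
characters `ε` of `G ⧸ H`, which lies in `I ^ p` (`normFun_sub_one_mem`). For `x, y ∈ I(H) ^ n`, the
difference `N(x + y) - N(x) - N(y)` is `p q` on `H` and `0` outside `H`, where
`q = ∑ (1 / p) (p choose i) xⁱ yᵖ⁻ⁱ`, summed over `0 < i < p`, lies in `I(H) ^ (n p)`. Since
restriction maps `I(G) ^ (n p)` onto `I(H) ^ (n p)`, this difference is an element of
`I(G) ^ (n p)` times `∑ ε` (`exists_normFun_add_eq`). As `I(H) ^ n` is additively generated by
products `χ ∏ (χᵢ - 1)` with `n` factors `χᵢ - 1`, the claim follows (`normFun_mem`).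
-/

namespace VirtualCharacter

/-! ### Representations of abelian groups as sums of linear characters -/

section Diagonalization

open Module

/-- The trace of an endomorphism which maps every vector of a basis to a multiple of a vector of
the basis. -/
theorem trace_eq_sum_of_apply_basis_eq_smul {ι M : Type*} [Fintype ι] [DecidableEq ι]
    [AddCommGroup M] [Module ℂ M] (b : Basis ι ℂ M) (f : M →ₗ[ℂ] M) (σ : ι → ι) (a : ι → ℂ)
    (h : ∀ i, f (b i) = a i • b (σ i)) :
    LinearMap.trace ℂ M f = ∑ i, if σ i = i then a i else 0 := by
  rw [LinearMap.trace_eq_matrix_trace ℂ b, Matrix.trace]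
  refine Finset.sum_congr rfl fun i _ => ?_
  rw [Matrix.diag_apply, LinearMap.toMatrix_apply, h]
  simp [Finsupp.single_apply]

variable {A : Type*} [CommGroup A]

/-- The basis `b` of `V` consists of simultaneous eigenvectors, `A` acting on the line of `b i`
through the linear character `χ i`. -/
def IsEigenbasis (V : FDRep ℂ A) {m : ℕ} (χ : Fin m → A →* ℂ) (b : Basis (Fin m) ℂ V) : Prop :=
  ∀ g i, V.ρ g (b i) = χ i g • b i

/-- Orthogonality of the linear characters of a finite abelian group. -/
theorem exists_sum_linearCharacter_eq [Finite A] [DecidableEq A] :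
    ∃ (s : Finset (A →* ℂ)) (c : ℂ), c ≠ 0 ∧ ∀ g : A, ∑ χ ∈ s, χ g = if g = 1 then c else 0 := by
  cases nonempty_fintype A
  let F : AddChar (Additive A) ℂ ↪ (A →* ℂ) :=
    ⟨fun ψ =>
      { toFun := fun a => ψ (Additive.ofMul a)
        map_one' := ψ.map_zero_eq_one
        map_mul' := fun a c => ψ.map_add_eq_mul _ _ }, by
      intro ψ φ h
      ext a
      exact DFunLike.congr_fun h a.toMul⟩
  refine ⟨Finset.univ.map F, (Fintype.card A : ℂ), by simp, fun g => ?_⟩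
  rw [Finset.sum_map]
  convert AddChar.sum_apply_eq_ite (Additive.ofMul g) using 1
  · exact Finset.sum_congr rfl fun _ _ => rfl
  · exact if_congr ofMul_eq_zero.symm (congrArg _ (Fintype.card_congr Additive.ofMul)) rfl

/-- A representation of a finite abelian group is a direct sum of linear characters. -/
theorem exists_isEigenbasis [Finite A] (V : FDRep ℂ A) :
    ∃ (m : ℕ) (χ : Fin m → A →* ℂ) (b : Basis (Fin m) ℂ V), IsEigenbasis V χ b := by
  classical
  cases nonempty_fintype A
  -- The simultaneous eigenvectors span: up to the factor `c`, a vector `v` is the sum of its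
  -- projections `∑ g, χ(g)⁻¹ g v` to the isotypic parts.
  let S : Set V := {v | ∃ χ : A →* ℂ, ∀ g, V.ρ g v = χ g • v}
  have hS : ⊤ ≤ Submodule.span ℂ S := by
    intro v _
    obtain ⟨s, c, hc, hs⟩ := exists_sum_linearCharacter_eq (A := A)
    have hv : v = c⁻¹ • ∑ χ ∈ s, ∑ g : A, χ g⁻¹ • V.ρ g v := by
      rw [Finset.sum_comm]
      simp_rw [← Finset.sum_smul, hs, inv_eq_one, ite_smul, zero_smul]
      simp [smul_smul, hc]
    rw [hv]
    refine Submodule.smul_mem _ _ (Submodule.sum_mem _ fun χ _ => Submodule.subset_span ⟨χ, ?_⟩)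
    intro h
    rw [map_sum, Finset.smul_sum]
    refine Fintype.sum_equiv (Equiv.mulLeft h) _ _ fun g => ?_
    have h1 : χ h * χ (h * g)⁻¹ = χ g⁻¹ := by rw [← map_mul, mul_inv, mul_inv_cancel_left]
    rw [Equiv.coe_mulLeft, map_smul, ← Module.End.mul_apply, ← map_mul, smul_smul, h1]
  let b := Basis.ofSpan hS
  have := FiniteDimensional.fintypeBasisIndex b
  have hb : ∀ i, b i ∈ S := fun i => Basis.ofSpan_subset hS ⟨i, rfl⟩
  choose χ hχ using hb
  let e := Fintype.equivFin ((linearIndepOn_empty ℂ id).extend (Set.empty_subset S))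
  refine ⟨_, fun i => χ (e.symm i), b.reindex e, fun g i => ?_⟩
  rw [Basis.reindex_apply]
  exact hχ _ g

variable {V : FDRep ℂ A} {m : ℕ} {χ : Fin m → A →* ℂ} {b : Basis (Fin m) ℂ V}

theorem IsEigenbasis.character_eq (h : IsEigenbasis V χ b) :
    V.character = ∑ i, ⇑(χ i) := by
  funext g
  rw [FDRep.character, trace_eq_sum_of_apply_basis_eq_smul b (V.ρ g) id (fun i => χ i g) (h g)]
  simp

theorem IsEigenbasis.exteriorCharacter_eq (h : IsEigenbasis V χ b) (n : ℕ) :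
    exteriorCharacter n V = ∑ s ∈ Finset.univ.powersetCard n, ∏ i ∈ s, ⇑(χ i) := by
  classical
  funext g
  rw [exteriorCharacter, trace_eq_sum_of_apply_basis_eq_smul (b.exteriorPower n) _ id
    (fun s => ∏ i ∈ s.1, χ i g)]
  · simp only [id, if_true, Finset.sum_apply, Finset.prod_apply]
    exact (Finset.sum_subtype _ (fun s => by simp [Set.powersetCard.mem_iff])
      (fun s => ∏ i ∈ s, χ i g)).symm
  · intro s
    rw [exteriorPower.basis_apply, exteriorPower.map_apply_ιMulti_family]
    have hs : ∏ i ∈ s.1, χ i g = ∏ j, χ (Set.powersetCard.ofFinEmbEquiv.symm s j) g := by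
      conv_lhs => rw [← Finset.map_orderEmbOfFin_univ s.1 s.2, Finset.prod_map]
      rfl
    rw [hs, id, exteriorPower.basis_apply]
    refine Eq.trans ?_ (AlternatingMap.map_smul_univ (exteriorPower.ιMulti ℂ n) _ _)
    change exteriorPower.ιMulti ℂ n _ = _
    congr 1
    funext j
    exact h g _

theorem IsEigenbasis.lambdaSeries_eq (h : IsEigenbasis V χ b) :
    lambdaSeries V = ∏ i, (1 + PowerSeries.C (χ i : A → ℂ) * PowerSeries.X) := by
  classical
  ext1 n
  rw [lambdaSeries, PowerSeries.coeff_mk, h.exteriorCharacter_eq, Finset.prod_one_add, map_sum,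
    Finset.powersetCard_eq_filter, Finset.sum_filter]
  refine Finset.sum_congr rfl fun s _ => ?_
  rw [Finset.prod_mul_distrib, Finset.prod_const, ← map_prod, PowerSeries.coeff_C_mul,
    PowerSeries.coeff_X_pow]
  simp [eq_comm]

theorem exists_isEigenbasis_of_linearCharacters (χ : Fin m → A →* ℂ) :
    ∃ (V : FDRep ℂ A) (b : Basis (Fin m) ℂ V), IsEigenbasis V χ b := by
  let ρ : Representation ℂ A (Fin m → ℂ) :=
    { toFun := fun g => LinearMap.pi fun i => χ i g • LinearMap.proj i
      map_one' := by ext; simp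
      map_mul' := fun g h => by ext; simp [mul_assoc] }
  refine ⟨FDRep.of ρ, Pi.basisFun ℂ (Fin m), fun g i => ?_⟩
  change ρ g (Pi.basisFun ℂ (Fin m) i) = χ i g • (Pi.basisFun ℂ (Fin m) i)
  ext j
  simp [ρ, Pi.single_apply]
  grind

end Diagonalization

/-! ### The substitution `t ↦ t / (1 + t)` -/

section PowerSeries

open PowerSeries

variable {R : Type*} [CommRing R]

theorem one_add_C_mul_X_mul_mk (c : R) :
    (1 + C c * X) * PowerSeries.mk (fun k => (-c) ^ k) = 1 := by
  ext k
  rw [add_mul, one_mul, mul_assoc, map_add, coeff_C_mul]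
  cases k with
  | zero => simp
  | succ k => rw [coeff_succ_X_mul]; simp [coeff_one, pow_succ]; ring

variable (R) in
/-- The power series `1 / (1 + t)`. -/
noncomputable def oneAddXInv : R⟦X⟧ := PowerSeries.mk fun k => (-1) ^ k

theorem one_add_X_mul_oneAddXInv : (1 + X) * oneAddXInv R = 1 := by
  simpa [oneAddXInv] using one_add_C_mul_X_mul_mk (1 : R)

variable (R) in
/-- The substitution `t ↦ t / (1 + t)`. -/
noncomputable def substDivOneAdd : R⟦X⟧ →ₐ[R] R⟦X⟧ :=
  PowerSeries.substAlgHom (a := (X * oneAddXInv R : R⟦X⟧))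
    (HasSubst.of_constantCoeff_zero' (by simp))

theorem substDivOneAdd_X : substDivOneAdd R X = X * oneAddXInv R :=
  PowerSeries.substAlgHom_X _

theorem substDivOneAdd_C (c : R) : substDivOneAdd R (C c) = C c :=
  (substDivOneAdd R).commutes c

/-- `λ_t(χ) = 1 + χ t` is `1 + t` times the value of `γ_u(χ - 1) = 1 + (χ - 1) u` at
`u = t / (1 + t)`. -/
theorem one_add_X_mul_substDivOneAdd (c : R) :
    (1 + X) * substDivOneAdd R (1 + C (c - 1) * X) = 1 + C c * X := by
  rw [map_add, map_mul, substDivOneAdd_C, substDivOneAdd_X, map_one, map_sub, map_one]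
  linear_combination ((C c - 1) * X) * one_add_X_mul_oneAddXInv (R := R)

theorem coeff_X_mul_oneAddXInv_pow_mul (m k : ℕ) (hk : k ≤ m) :
    coeff m ((X * oneAddXInv R) ^ k * (1 + X) ^ m * oneAddXInv R) = if k = m then 1 else 0 := by
  have h (j : ℕ) : oneAddXInv R ^ j * (1 + X) ^ j = 1 := by
    rw [← mul_pow, mul_comm, one_add_X_mul_oneAddXInv, one_pow]
  obtain ⟨j, rfl⟩ := Nat.exists_eq_add_of_le hk
  have h1 : (X * oneAddXInv R) ^ k * (1 + X) ^ (k + j) * oneAddXInv R =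
      X ^ k * ((1 + X) ^ j * oneAddXInv R) := by
    linear_combination (X ^ k * ((1 + X) ^ j * oneAddXInv R)) * h k
  rw [h1, add_comm k j, coeff_X_pow_mul]
  cases j with
  | zero => simp [oneAddXInv]
  | succ j =>
    have h2 : (1 + X : R⟦X⟧) ^ (j + 1) * oneAddXInv R = ((1 + Polynomial.X) ^ j : Polynomial R) := by
      push_cast
      linear_combination (1 + X) ^ j * one_add_X_mul_oneAddXInv (R := R)
    rw [h2, Polynomial.coeff_coe, add_comm, Polynomial.coeff_X_add_one_pow]
    simp

/-- The reparametrization relating `λ` and `γ` operations: the coefficient of `t ^ m` in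
`(1 + t) ^ (m - 1) * f (t / (1 + t))` is the coefficient of `t ^ m` in `f`. -/
theorem coeff_eq_of_mul_one_add_X_eq {s f : R⟦X⟧} {m : ℕ}
    (h : s * (1 + X) = substDivOneAdd R f * (1 + X) ^ m) : coeff m s = coeff m f := by
  have hs : s = substDivOneAdd R f * (1 + X) ^ m * oneAddXInv R := by
    rw [← h, mul_assoc, one_add_X_mul_oneAddXInv, mul_one]
  -- Only the truncation of `f` matters, as `t ^ (m + 1)` is sent to a multiple of itself.
  have hf : f = ∑ k ∈ Finset.range (m + 1), C (coeff k f) * X ^ k +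
      X ^ (m + 1) * PowerSeries.mk (fun k => coeff (k + (m + 1)) f) := by
    ext k
    rw [map_add, coeff_X_pow_mul', map_sum]
    simp only [coeff_C_mul, coeff_X_pow, mul_ite, mul_one, mul_zero, Finset.sum_ite_eq,
      Finset.mem_range, coeff_mk]
    grind
  rw [hs]
  conv_lhs => rw [hf]
  rw [map_add (substDivOneAdd R), map_mul (substDivOneAdd R), map_pow (substDivOneAdd R),
    substDivOneAdd_X, map_sum (substDivOneAdd R), add_mul, add_mul, map_add]
  have h0 (g : R⟦X⟧) :
      coeff m ((X * oneAddXInv R) ^ (m + 1) * g * (1 + X) ^ m * oneAddXInv R) = 0 := by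
    rw [mul_pow, mul_assoc, mul_assoc, mul_assoc, coeff_X_pow_mul', if_neg (by omega)]
  rw [h0, add_zero, Finset.sum_mul, Finset.sum_mul, map_sum, Finset.sum_eq_single m]
  · rw [map_mul (substDivOneAdd R), map_pow (substDivOneAdd R), substDivOneAdd_X,
      substDivOneAdd_C, mul_assoc, mul_assoc, coeff_C_mul, ← mul_assoc,
      coeff_X_mul_oneAddXInv_pow_mul _ _ le_rfl, if_pos rfl, mul_one]
  · intro k hk hkm
    rw [map_mul (substDivOneAdd R), map_pow (substDivOneAdd R), substDivOneAdd_X,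
      substDivOneAdd_C, mul_assoc, mul_assoc, coeff_C_mul, ← mul_assoc,
      coeff_X_mul_oneAddXInv_pow_mul _ _ (by grind), if_neg hkm, mul_zero]
  · simp

end PowerSeries

/-! ### The Grothendieck filtration of an abelian group is the filtration by powers of `I` -/

section Powers

variable (A : Type*) [CommGroup A]

/-- The additive span of the linear characters. For finite abelian `A` it is `R(A)`. -/
def linearSpan : Submodule ℤ (A → ℂ) :=
  Submodule.span ℤ (Set.range fun χ : A →* ℂ => (χ : A → ℂ))

/-- The additive span of the differences `χ - 1`, for `χ` a linear character. For finite
abelian `A` it is the augmentation ideal. -/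
def linearAugmentation : Submodule ℤ (A → ℂ) :=
  Submodule.span ℤ (Set.range fun χ : A →* ℂ => (χ : A → ℂ) - 1)

/-- The `n`-th power of the augmentation ideal. The factor `linearSpan A` makes the `0`-th power
the whole of `R(A)` rather than the constants. -/
def augmentationPower (n : ℕ) : Submodule ℤ (A → ℂ) := linearSpan A * linearAugmentation A ^ n

variable {A}

theorem coe_mem_linearSpan (χ : A →* ℂ) : (χ : A → ℂ) ∈ linearSpan A :=
  Submodule.subset_span ⟨χ, rfl⟩

theorem one_mem_linearSpan : (1 : A → ℂ) ∈ linearSpan A := coe_mem_linearSpan (1 : A →* ℂ)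

theorem linearSpan_mul_linearSpan : linearSpan A * linearSpan A = linearSpan A := by
  refine le_antisymm ?_ (le_mul_of_one_le_left' (Submodule.one_le.2 one_mem_linearSpan))
  rw [linearSpan, Submodule.span_mul_span, Submodule.span_le]
  rintro _ ⟨_, ⟨χ, rfl⟩, _, ⟨ψ, rfl⟩, rfl⟩
  exact coe_mem_linearSpan (χ * ψ)

theorem linearAugmentation_le_linearSpan : linearAugmentation A ≤ linearSpan A := by
  rw [linearAugmentation, Submodule.span_le]
  rintro _ ⟨χ, rfl⟩
  exact sub_mem (coe_mem_linearSpan χ) one_mem_linearSpan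

theorem augmentationPower_mul (m n : ℕ) :
    augmentationPower A m * augmentationPower A n = augmentationPower A (m + n) := by
  rw [augmentationPower, augmentationPower, mul_mul_mul_comm, linearSpan_mul_linearSpan, ← pow_add,
    augmentationPower]

theorem augmentationPower_zero : augmentationPower A 0 = linearSpan A := by
  rw [augmentationPower, pow_zero, mul_one]

theorem augmentationPower_antitone : Antitone (augmentationPower A) := by
  refine antitone_nat_of_succ_le fun n => ?_
  rw [augmentationPower, augmentationPower, pow_succ', ← mul_assoc]
  refine mul_le_mul_left ((mul_le_mul_right linearAugmentation_le_linearSpan _).trans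
    linearSpan_mul_linearSpan.le) _

theorem mul_mem_augmentationPower {m n : ℕ} {x y : A → ℂ} (hx : x ∈ augmentationPower A m)
    (hy : y ∈ augmentationPower A n) : x * y ∈ augmentationPower A (m + n) := by
  rw [← augmentationPower_mul]
  exact Submodule.mul_mem_mul hx hy

theorem one_mem_augmentationPower_zero : (1 : A → ℂ) ∈ augmentationPower A 0 := by
  rw [augmentationPower_zero]
  exact one_mem_linearSpan

theorem prod_mem_augmentationPower {ι : Type*} (s : Finset ι) (m : ι → ℕ) (x : ι → A → ℂ)
    (h : ∀ i ∈ s, x i ∈ augmentationPower A (m i)) :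
    ∏ i ∈ s, x i ∈ augmentationPower A (∑ i ∈ s, m i) := by
  classical
  induction s using Finset.induction_on with
  | empty => exact one_mem_augmentationPower_zero
  | insert a s ha ih =>
    rw [Finset.prod_insert ha, Finset.sum_insert ha]
    exact mul_mem_augmentationPower (h _ (Finset.mem_insert_self _ _))
      (ih fun i hi => h i (Finset.mem_insert_of_mem hi))

theorem pow_mem_augmentationPower {m : ℕ} {x : A → ℂ} (hx : x ∈ augmentationPower A m) (k : ℕ) :
    x ^ k ∈ augmentationPower A (m * k) := by
  simpa [mul_comm] using prod_mem_augmentationPower (Finset.range k) (fun _ => m) (fun _ => x)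
    fun _ _ => hx

theorem mem_augmentationPower_one {x : A → ℂ} (hx : x ∈ linearAugmentation A) :
    x ∈ augmentationPower A 1 := by
  rw [augmentationPower, pow_one, ← one_mul x]
  exact Submodule.mul_mem_mul one_mem_linearSpan hx

theorem sub_one_mem_augmentationPower_one (χ : A →* ℂ) :
    (χ : A → ℂ) - 1 ∈ augmentationPower A 1 :=
  mem_augmentationPower_one (Submodule.subset_span ⟨χ, rfl⟩)

open scoped Pointwise in
theorem augmentationPower_eq_span (n : ℕ) : augmentationPower A n =
    Submodule.span ℤ ((Set.range fun χ : A →* ℂ => (χ : A → ℂ)) *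
      (Set.range fun χ : A →* ℂ => (χ : A → ℂ) - 1) ^ n) := by
  rw [augmentationPower, linearSpan, linearAugmentation, Submodule.span_pow,
    Submodule.span_mul_span]

/-- The power series whose `k`-th coefficient lies in the `k`-th power of the augmentation ideal are
closed under products. -/
theorem coeff_mul_mem_augmentationPower {f g : PowerSeries (A → ℂ)}
    (hf : ∀ k, f.coeff k ∈ augmentationPower A k) (hg : ∀ k, g.coeff k ∈ augmentationPower A k)
    (k : ℕ) : (f * g).coeff k ∈ augmentationPower A k := by
  rw [PowerSeries.coeff_mul]
  refine Submodule.sum_mem _ fun ij hij => ?_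
  rw [← Finset.HasAntidiagonal.mem_antidiagonal.1 hij]
  exact mul_mem_augmentationPower (hf _) (hg _)

theorem coeff_prod_mem_augmentationPower {ι : Type*} (s : Finset ι)
    {f : ι → PowerSeries (A → ℂ)} (hf : ∀ i k, (f i).coeff k ∈ augmentationPower A k) :
    ∀ k, (∏ i ∈ s, f i).coeff k ∈ augmentationPower A k := by
  classical
  induction s using Finset.induction_on with
  | empty =>
    intro k
    rw [Finset.prod_empty, PowerSeries.coeff_one]
    split_ifs with h
    · rw [h]; exact one_mem_augmentationPower_zero
    · exact zero_mem _
  | insert a s ha ih =>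
    rw [Finset.prod_insert ha]
    exact coeff_mul_mem_augmentationPower (hf a) ih

theorem coeff_one_add_mem_augmentationPower (χ : A →* ℂ) (k : ℕ) :
    (1 + PowerSeries.C ((χ : A → ℂ) - 1) * PowerSeries.X).coeff k ∈ augmentationPower A k := by
  rw [map_add, PowerSeries.coeff_one, PowerSeries.coeff_C_mul, PowerSeries.coeff_X]
  match k with
  | 0 => simpa using one_mem_augmentationPower_zero
  | 1 => simpa using sub_one_mem_augmentationPower_one χ
  | k + 2 => simp

/-- `γ ^ m` maps the augmentation ideal into its `m`-th power: for `x = ∑ χᵢ - ∑ ψⱼ` of degree `0`,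
`γ_t(x) = ∏ (1 + (χᵢ - 1) t) / ∏ (1 + (ψⱼ - 1) t)`. -/
theorem IsGamma.mem_augmentationPower [Finite A] {m : ℕ} {x z : A → ℂ} (h : IsGamma m x z)
    (hx : x 1 = 0) : z ∈ augmentationPower A m := by
  obtain ⟨V, W, s, hVW, hs, rfl⟩ := h
  obtain ⟨d, χ, b, hb⟩ := exists_isEigenbasis V
  obtain ⟨e, ψ, c, hc⟩ := exists_isEigenbasis W
  -- The degrees of `V` and `W` differ by `m - 1`; the form with `+ 1` also covers `m = 0`.
  have hdeg : d + 1 = e + m := by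
    have := congrFun hVW 1
    rw [hb.character_eq, hc.character_eq] at this
    simp [hx] at this
    have h2 : ((d + 1 : ℕ) : ℂ) = ((e + m : ℕ) : ℂ) := by
      push_cast
      linear_combination -this
    exact_mod_cast h2
  let F := ∏ i, (1 + PowerSeries.C ((χ i : A → ℂ) - 1) * PowerSeries.X)
  let E := ∏ j, (1 + PowerSeries.C ((ψ j : A → ℂ) - 1) * PowerSeries.X)
  let E' := ∏ j, PowerSeries.mk (fun k => (-((ψ j : A → ℂ) - 1)) ^ k)
  have hE : E * E' = 1 := by
    rw [← Finset.prod_mul_distrib]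
    exact Finset.prod_eq_one fun j _ => one_add_C_mul_X_mul_mk _
  have hprod {r : ℕ} (θ : Fin r → A →* ℂ) :
      ∏ i, (1 + PowerSeries.C (θ i : A → ℂ) * PowerSeries.X) = (1 + PowerSeries.X) ^ r *
        substDivOneAdd _ (∏ i, (1 + PowerSeries.C ((θ i : A → ℂ) - 1) * PowerSeries.X)) := by
    rw [map_prod, Finset.prod_congr rfl fun i _ =>
        (one_add_X_mul_substDivOneAdd (θ i : A → ℂ)).symm,
      Finset.prod_mul_distrib, Finset.prod_const, Finset.card_univ, Fintype.card_fin]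
  rw [hb.lambdaSeries_eq, hc.lambdaSeries_eq, hprod, hprod] at hs
  have key : s * (1 + PowerSeries.X) =
      substDivOneAdd _ (F * E') * (1 + PowerSeries.X) ^ m := by
    have hEE : substDivOneAdd _ E * substDivOneAdd _ E' = 1 := by rw [← map_mul, hE, map_one]
    have hX : (1 + PowerSeries.X : PowerSeries (A → ℂ)) ^ e * oneAddXInv _ ^ e = 1 := by
      rw [← mul_pow, one_add_X_mul_oneAddXInv, one_pow]
    have hde : (1 + PowerSeries.X : PowerSeries (A → ℂ)) ^ d * (1 + PowerSeries.X) =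
        (1 + PowerSeries.X) ^ e * (1 + PowerSeries.X) ^ m := by
      rw [← pow_succ, hdeg, pow_add]
    change s * ((1 + PowerSeries.X) ^ e * substDivOneAdd _ E) =
      (1 + PowerSeries.X) ^ d * substDivOneAdd _ F at hs
    rw [map_mul]
    generalize substDivOneAdd _ E = P at *
    generalize substDivOneAdd _ E' = P' at *
    generalize substDivOneAdd _ F = Q at *
    generalize (1 + PowerSeries.X : PowerSeries (A → ℂ)) ^ e = u at *
    generalize (1 + PowerSeries.X : PowerSeries (A → ℂ)) ^ d = v at *
    generalize (1 + PowerSeries.X : PowerSeries (A → ℂ)) ^ m = w at *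
    generalize (1 + PowerSeries.X : PowerSeries (A → ℂ)) = t at *
    generalize oneAddXInv (A → ℂ) ^ e = u' at *
    calc s * t = (s * (u * P)) * t * u' * P' := by
          linear_combination (-s * t * u * u') * hEE - s * t * hX
      _ = Q * P' * w * (u * u') := by
          rw [hs]
          linear_combination Q * u' * P' * hde
      _ = _ := by rw [hX, mul_one]
  rw [coeff_eq_of_mul_one_add_X_eq key]
  refine coeff_mul_mem_augmentationPower
    (coeff_prod_mem_augmentationPower _ fun i => coeff_one_add_mem_augmentationPower (χ i))
    (coeff_prod_mem_augmentationPower _ fun j k => ?_) m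
  rw [PowerSeries.coeff_mk]
  simpa using pow_mem_augmentationPower (neg_mem (sub_one_mem_augmentationPower_one (ψ j))) k

theorem gammaFiltration_le_augmentationPower [Finite A] (n : ℕ) :
    gammaFiltration A n ≤ (augmentationPower A n).toAddSubgroup := by
  rw [gammaFiltration, AddSubgroup.closure_le]
  rintro _ ⟨k, m, x, z, hx, hz, hn, rfl⟩
  exact augmentationPower_antitone hn (prod_mem_augmentationPower _ _ _
    fun i _ => (hz i).mem_augmentationPower (hx i).2)

theorem exists_character_eq_linearCharacter (χ : A →* ℂ) :
    ∃ V : FDRep ℂ A, V.character = χ ∧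
      lambdaSeries V = 1 + PowerSeries.C (χ : A → ℂ) * PowerSeries.X := by
  obtain ⟨V, b, hb⟩ := exists_isEigenbasis_of_linearCharacters (fun _ : Fin 1 => χ)
  exact ⟨V, by simp [hb.character_eq], by simp [hb.lambdaSeries_eq]⟩

theorem isGamma_one_sub_one (χ : A →* ℂ) : IsGamma 1 ((χ : A → ℂ) - 1) ((χ : A → ℂ) - 1) := by
  obtain ⟨V, hV, hV'⟩ := exists_character_eq_linearCharacter χ
  obtain ⟨W, hW, hW'⟩ := exists_character_eq_linearCharacter (1 : A →* ℂ)
  refine ⟨V, W, (1 + PowerSeries.C (χ : A → ℂ) * PowerSeries.X) *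
    PowerSeries.mk (fun k => (-1) ^ k), ?_, ?_, ?_⟩
  · rw [hV, hW]; simp; rfl
  · have := one_add_C_mul_X_mul_mk (1 : A → ℂ)
    rw [hV', hW', show ⇑(1 : A →* ℂ) = 1 from rfl]
    linear_combination (1 + PowerSeries.C (χ : A → ℂ) * PowerSeries.X) * this
  · rw [add_mul, mul_assoc, one_mul, map_add, PowerSeries.coeff_C_mul,
      PowerSeries.coeff_succ_X_mul]
    simp
    ring

theorem sub_one_mem_augmentationIdeal (χ : A →* ℂ) :
    (χ : A → ℂ) - 1 ∈ augmentationIdeal (G := A) := by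
  obtain ⟨V, hV, -⟩ := exists_character_eq_linearCharacter χ
  refine ⟨sub_mem ?_ (one_mem _), by simp⟩
  exact AddSubgroup.subset_closure ⟨V, hV⟩

open scoped Pointwise in
theorem augmentationPower_le_gammaFiltration (n : ℕ) :
    (augmentationPower A n).toAddSubgroup ≤ gammaFiltration A n := by
  rw [augmentationPower_eq_span, Submodule.span_int_eq_addSubgroupClosure, AddSubgroup.closure_le]
  rintro _ ⟨_, ⟨χ, rfl⟩, y, hy, rfl⟩
  obtain ⟨f, rfl⟩ := Set.mem_pow.1 hy
  have hmem {k : ℕ} (θ : Fin k → A →* ℂ) (hk : n ≤ k) :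
      ∏ i, ((θ i : A → ℂ) - 1) ∈ gammaFiltration A n :=
    AddSubgroup.subset_closure ⟨k, fun _ => 1, _, _,
      fun i => sub_one_mem_augmentationIdeal (θ i), fun i => isGamma_one_sub_one (θ i),
      by simpa using hk, rfl⟩
  choose θ hθ using fun i => (f i).2
  -- `χ ∏ (θᵢ - 1) = (χ - 1) ∏ (θᵢ - 1) + ∏ (θᵢ - 1)`
  have h1 := hmem θ le_rfl
  have h2 := hmem (Fin.cons χ θ : Fin (n + 1) → A →* ℂ) (Nat.le_succ n)
  rw [Fin.prod_univ_succ] at h2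
  have h3 := add_mem h2 h1
  simp only [Fin.cons_zero, Fin.cons_succ] at h3
  have hy : (List.ofFn fun i => (f i : A → ℂ)).prod = ∏ i, ((θ i : A → ℂ) - 1) := by
    rw [List.prod_ofFn]
    exact Finset.prod_congr rfl fun i _ => (hθ i).symm
  change (χ : A → ℂ) * _ ∈ gammaFiltration A n
  rw [hy]
  convert h3 using 1
  ring

end Powers

/-! ### An explicit formula for the norm -/

section NormFormula

open Module

variable {G : Type*} [CommGroup G] {H : Subgroup G}

theorem smul_eq_self_of_mem {g : G} (hg : g ∈ H) (c : G ⧸ H) : g • c = c := by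
  induction c using QuotientGroup.induction_on with
  | H a =>
    rw [MulAction.Quotient.smul_coe, QuotientGroup.eq]
    simpa [mul_comm] using hg

theorem stabilizes_of_mem {g : G} (hg : g ∈ H) (C : Finset (G ⧸ H)) : Stabilizes g C :=
  fun c => by rw [smul_eq_self_of_mem hg]

theorem cosetCocycle_of_mem {g : G} (hg : g ∈ H) (c : G ⧸ H) : cosetCocycle g c = ⟨g, hg⟩ := by
  ext
  simp [cosetCocycle, smul_eq_self_of_mem hg, mul_comm g]

/-- The product of the cocycle over all cosets is the transfer of `g`, which for an abelian group
is `g ^ [G : H]`. -/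
theorem prod_cosetCocycle [Fintype (G ⧸ H)] (g : G) :
    ∏ c, cosetCocycle (H := H) g c = ⟨g ^ H.index, H.pow_index_mem g⟩ := by
  ext
  rw [Subgroup.val_finsetProd]
  simp only [cosetCocycle]
  rw [Finset.prod_mul_distrib, Finset.prod_mul_distrib, Finset.prod_const, Finset.card_univ,
    Finset.prod_inv_distrib, ← Nat.card_eq_fintype_card, ← Subgroup.index,
    show ∏ c : G ⧸ H, (g • c).out = ∏ c : G ⧸ H, c.out from
      Equiv.prod_comp (MulAction.toPerm g : Equiv.Perm (G ⧸ H)) (fun c => c.out)]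
  simp [mul_comm (g ^ _)]

theorem exists_pow_smul_eq (hH : H.index.Prime) {g : G} (hg : g ∉ H) (c d : G ⧸ H) :
    ∃ k : ℕ, g ^ k • c = d := by
  have := Fact.mk hH
  obtain ⟨k, hk⟩ := mem_powers_of_prime_card (G := G ⧸ H) (p := H.index) rfl (g := (g : G ⧸ H))
    (g' := d * c⁻¹) (by rwa [Ne, QuotientGroup.eq_one_iff])
  refine ⟨k, ?_⟩
  have h : g ^ k • c = ((g : G ⧸ H)) ^ k * c := by
    induction c using QuotientGroup.induction_on with
    | H a => rfl
  rw [h]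
  simp only at hk
  rw [hk, inv_mul_cancel_right]

theorem Stabilizes.pow_smul_mem {g : G} {C : Finset (G ⧸ H)} (h : Stabilizes g C) {c : G ⧸ H}
    (hc : c ∈ C) (k : ℕ) : g ^ k • c ∈ C := by
  induction k with
  | zero => simpa
  | succ k ih => rwa [pow_succ', mul_smul, h]

/-- An element outside a subgroup of prime index permutes the cosets cyclically. -/
theorem stabilizes_iff_of_notMem [Fintype (G ⧸ H)] (hH : H.index.Prime) {g : G} (hg : g ∉ H)
    (C : Finset (G ⧸ H)) : Stabilizes g C ↔ C = ∅ ∨ C = Finset.univ := by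
  refine ⟨fun h => ?_, ?_⟩
  · rw [or_iff_not_imp_left]
    intro hC
    obtain ⟨c, hc⟩ := Finset.nonempty_iff_ne_empty.2 hC
    refine Finset.eq_univ_iff_forall.2 fun d => ?_
    obtain ⟨k, rfl⟩ := exists_pow_smul_eq hH hg c d
    exact h.pow_smul_mem hc k
  · rintro (rfl | rfl) c <;> simp

variable {W : FDRep ℂ H} {m : ℕ} {χ : Fin m → H →* ℂ} {b : Basis (Fin m) ℂ W}

open scoped Classical in
/-- In the basis of pure tensors of eigenvectors, indexed by functions `f` on `C`, the element `g`
acts by a monomial matrix; only the `f` that are invariant under `g` contribute to the trace. -/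
theorem IsEigenbasis.trace_tensorAction (hb : IsEigenbasis W χ b) {g : G} {C : Finset (G ⧸ H)}
    (h : Stabilizes g C) : LinearMap.trace ℂ (⨂[ℂ] _ : C, W) (tensorAction W g C h) =
      ∑ f : C → Fin m, if (∀ c : C, f ⟨g • (c : G ⧸ H), (h c).2 c.2⟩ = f c) then
        ∏ c : C, χ (f c) (cosetCocycle g c) else 0 := by
  let σ : Equiv.Perm C := (MulAction.toPerm g : Equiv.Perm (G ⧸ H)).subtypePerm h
  rw [trace_eq_sum_of_apply_basis_eq_smul (Basis.piTensorProduct fun _ : C => b)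
    (tensorAction W g C h) (fun f c => f (σ.symm c)) (fun f => ∏ c, χ (f c) (cosetCocycle g c))]
  · refine Finset.sum_congr rfl fun f _ => ?_
    congr 1
    refine propext ⟨fun hf c => ?_, fun hf => funext fun c => ?_⟩
    · have := congrFun hf (σ c)
      rw [σ.symm_apply_apply] at this
      exact this.symm
    · have := hf (σ.symm c)
      have h2 : (⟨g • (σ.symm c : G ⧸ H), (h _).2 (σ.symm c).2⟩ : C) = c := σ.apply_symm_apply c
      rw [← this, h2]
  · intro f
    rw [Basis.piTensorProduct_apply, Basis.piTensorProduct_apply]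
    have h1 : PiTensorProduct.map (fun c : C => W.ρ (cosetCocycle g c))
        (⨂ₜ[ℂ] c, b (f c)) = (∏ c, χ (f c) (cosetCocycle g c)) • ⨂ₜ[ℂ] c, b (f c) := by
      rw [PiTensorProduct.map_tprod, ← MultilinearMap.map_smul_univ]
      congr 1
      funext c
      exact hb _ _
    change PiTensorProduct.reindex ℂ (fun _ : C => (W : Type)) σ
      (PiTensorProduct.map (fun c : C => W.ρ (cosetCocycle g c)) (⨂ₜ[ℂ] c, b (f c))) = _
    rw [h1, map_smul]
    congr 1
    exact PiTensorProduct.reindex_tprod _ _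

theorem chi_empty [Finite G] (W : FDRep ℂ H) (g : G) : chi W g ∅ = 1 := by
  classical
  obtain ⟨m, χ, b, hb⟩ := exists_isEigenbasis (A := H) W
  have h : Stabilizes g (∅ : Finset (G ⧸ H)) := fun c => by simp
  rw [chi, dif_pos h, hb.trace_tensorAction]
  simp

theorem chi_of_mem [Finite G] (W : FDRep ℂ H) {g : G} (hg : g ∈ H) (C : Finset (G ⧸ H)) :
    chi W g C = W.character ⟨g, hg⟩ ^ C.card := by
  classical
  obtain ⟨m, χ, b, hb⟩ := exists_isEigenbasis (A := H) W
  rw [chi, dif_pos (stabilizes_of_mem hg C), hb.trace_tensorAction, hb.character_eq,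
    Finset.sum_apply]
  simp only [smul_eq_self_of_mem hg, cosetCocycle_of_mem hg, Subtype.coe_eta, implies_true, if_true]
  rw [← Fintype.card_coe, ← Finset.card_univ, ← Finset.prod_const, Finset.prod_univ_sum,
    Fintype.piFinset_univ]

/-- The trace of a cyclic permutation of the tensor factors, twisted by the cocycle. -/
theorem chi_univ_of_notMem [Finite G] [Fintype (G ⧸ H)] (hH : H.index.Prime) (W : FDRep ℂ H)
    {g : G} (hg : g ∉ H) :
    chi W g Finset.univ = W.character ⟨g ^ H.index, H.pow_index_mem g⟩ := by
  classical
  obtain ⟨m, χ, b, hb⟩ := exists_isEigenbasis (A := H) W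
  rw [chi, dif_pos ((stabilizes_iff_of_notMem hH hg _).2 (Or.inr rfl)), hb.trace_tensorAction,
    hb.character_eq, Finset.sum_apply, ← Finset.sum_filter]
  -- As `g` is transitive on the cosets, the invariant functions are the constant ones.
  have himage : (Finset.univ.filter fun (f : ↥(Finset.univ : Finset (G ⧸ H)) → Fin m) =>
      ∀ c : ↥(Finset.univ : Finset (G ⧸ H)), f ⟨g • (c : G ⧸ H), Finset.mem_univ _⟩ = f c) =
      Finset.univ.image (fun i _ => i) := by
    ext f
    simp only [Finset.mem_filter, Finset.mem_univ, true_and, Finset.mem_image]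
    refine ⟨fun hf => ⟨f ⟨((1 : G) : G ⧸ H), Finset.mem_univ _⟩, funext fun c => ?_⟩, ?_⟩
    · obtain ⟨k, hk⟩ := exists_pow_smul_eq hH hg ((1 : G) : G ⧸ H) c
      have (k : ℕ) : f ⟨g ^ k • ((1 : G) : G ⧸ H), Finset.mem_univ _⟩ =
          f ⟨((1 : G) : G ⧸ H), Finset.mem_univ _⟩ := by
        induction k with
        | zero => simp
        | succ k ih =>
          exact (congrArg f (Subtype.ext (by rw [pow_succ', mul_smul]))).trans
            ((hf ⟨g ^ k • ((1 : G) : G ⧸ H), Finset.mem_univ _⟩).trans ih)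
      rw [← this k]
      congr 1
      exact Subtype.ext hk
    · rintro ⟨i, rfl⟩ c
      rfl
  rw [himage, Finset.sum_image fun i _ j _ hij =>
    congrFun hij ⟨((1 : G) : G ⧸ H), Finset.mem_univ _⟩]
  refine Finset.sum_congr rfl fun i _ => ?_
  rw [← map_prod, ← prod_cosetCocycle g,
    Finset.prod_coe_sort Finset.univ (fun c => cosetCocycle (H := H) g c)]

open scoped Classical in
/-- The explicit formula for the norm from a subgroup `H` of prime index `p` of an abelian group:
`x(g) ^ p` for `g ∈ H`, and `x(g ^ p)` for `g ∉ H`. -/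
noncomputable def normFun (x : H → ℂ) (g : G) : ℂ :=
  if h : g ∈ H then x ⟨g, h⟩ ^ H.index else x ⟨g ^ H.index, H.pow_index_mem g⟩

theorem normFun_of_mem (x : H → ℂ) {g : G} (h : g ∈ H) : normFun x g = x ⟨g, h⟩ ^ H.index :=
  dif_pos h

theorem normFun_of_notMem (x : H → ℂ) {g : G} (h : g ∉ H) :
    normFun x g = x ⟨g ^ H.index, H.pow_index_mem g⟩ :=
  dif_neg h

theorem vee_chi_of_mem [Finite G] [DecidableEq (G ⧸ H)] (W : FDRep ℂ H)
    (z : G → Finset (G ⧸ H) → ℂ) {g : G} (hg : g ∈ H) (C : Finset (G ⧸ H)) :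
    vee (chi W) z g C = ∑ D ∈ C.powerset, W.character ⟨g, hg⟩ ^ D.card * z g (C \ D) := by
  classical
  rw [vee, Finset.filter_true_of_mem fun D _ => stabilizes_of_mem hg D]
  refine Finset.sum_congr (by congr!) fun D _ => ?_
  rw [chi_of_mem W hg]
  congr!

theorem sum_powerset_pow_card_mul_pow_card_sdiff {α : Type*} [DecidableEq α] (C : Finset α)
    (u v : ℂ) : ∑ D ∈ C.powerset, u ^ D.card * v ^ (C \ D).card = (u + v) ^ C.card := by
  rw [← Finset.sum_pow_mul_eq_add_pow]
  refine Finset.sum_congr rfl fun D hD => ?_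
  rw [Finset.card_sdiff_of_subset (Finset.mem_powerset.1 hD)]

theorem vee_of_notMem [Fintype (G ⧸ H)] (hH : H.index.Prime) (z t : G → Finset (G ⧸ H) → ℂ)
    {g : G} (hg : g ∉ H) :
    vee z t g Finset.univ = z g ∅ * t g Finset.univ + z g Finset.univ * t g ∅ := by
  classical
  have h : (Finset.univ : Finset (G ⧸ H)).powerset.filter (Stabilizes g) = {∅, Finset.univ} := by
    ext D
    simp [stabilizes_iff_of_notMem hH hg]
  rw [vee]
  trans ∑ D ∈ {∅, Finset.univ}, z g D * t g (Finset.univ \ D)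
  · refine Finset.sum_congr (by rw [← h]) fun D _ => by congr!
  · rw [Finset.sum_pair Finset.univ_nonempty.ne_empty.symm]
    simp

/-- The inverse of `χ(τ)` is `(-τ(g)) ^ |C|` on the elements `g` of `H`. -/
theorem eq_pow_card_of_vee_eq_veeOne [Finite G] (τ : FDRep ℂ H) {b : G → Finset (G ⧸ H) → ℂ}
    {g : G} (hg : g ∈ H) (h : ∀ C, vee (chi τ) b g C = veeOne g C) (C : Finset (G ⧸ H)) :
    b g C = (-τ.character ⟨g, hg⟩) ^ C.card := by
  classical
  induction C using Finset.strongInduction with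
  | H C ih =>
    have h1 := h C
    rw [vee_chi_of_mem τ b hg] at h1
    have h2 := sum_powerset_pow_card_mul_pow_card_sdiff C (τ.character ⟨g, hg⟩)
      (-τ.character ⟨g, hg⟩)
    rw [add_neg_cancel] at h2
    have h3 : veeOne g C = (0 : ℂ) ^ C.card := by
      rw [veeOne]
      split_ifs with hC
      · simp [hC]
      · rw [zero_pow (by simpa using hC)]
    rw [h3, ← h2, ← Finset.add_sum_erase _ _ (Finset.empty_mem_powerset C),
      ← Finset.add_sum_erase _ _ (Finset.empty_mem_powerset C)] at h1
    have h4 : ∑ D ∈ C.powerset.erase ∅, τ.character ⟨g, hg⟩ ^ D.card * b g (C \ D) =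
        ∑ D ∈ C.powerset.erase ∅,
          τ.character ⟨g, hg⟩ ^ D.card * (-τ.character ⟨g, hg⟩) ^ (C \ D).card := by
      refine Finset.sum_congr rfl fun D hD => ?_
      rw [Finset.mem_erase, Finset.mem_powerset] at hD
      rw [ih (C \ D) (Finset.sdiff_ssubset hD.2 (Finset.nonempty_iff_ne_empty.2 hD.1))]
    rw [h4] at h1
    simpa using add_right_cancel h1

/-- On `g ∈ H` the convolution of `σ(g) ^ |C|` with `(-τ(g)) ^ |C|` is `(σ(g) - τ(g)) ^ |C|`. For
`g ∉ H` only `∅` and the full set are stabilized, and the inverse of `χ(τ)` is `1` on `∅` and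
`-τ(g ^ p)` on the full set. -/
theorem IsNorm.eq_normFun [Finite G] [Fintype (G ⧸ H)] (hH : H.index.Prime) {x : H → ℂ}
    {y : G → ℂ} (h : IsNorm x y) : y = normFun x := by
  classical
  obtain ⟨σ, τ, b, rfl, hb, hy⟩ := h
  funext g
  rw [hy]
  by_cases hg : g ∈ H
  · rw [vee_chi_of_mem σ b hg, normFun_of_mem _ hg, Subgroup.index, Nat.card_eq_fintype_card,
      ← Finset.card_univ, Pi.sub_apply, sub_eq_add_neg,
      ← sum_powerset_pow_card_mul_pow_card_sdiff]
    refine Finset.sum_congr rfl fun D _ => ?_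
    rw [eq_pow_card_of_vee_eq_veeOne τ hg fun C => hb g C (stabilizes_of_mem hg C)]
  · rw [vee_of_notMem hH _ _ hg, normFun_of_notMem _ hg, chi_empty, chi_univ_of_notMem hH _ hg]
    have h0 := hb g ∅ ((stabilizes_iff_of_notMem hH hg _).2 (Or.inl rfl))
    have h1 := hb g Finset.univ ((stabilizes_iff_of_notMem hH hg _).2 (Or.inr rfl))
    rw [vee_of_notMem hH _ _ hg, chi_empty, chi_univ_of_notMem hH _ hg, veeOne,
      if_neg Finset.univ_nonempty.ne_empty] at h1
    have h2 : b g ∅ = 1 := by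
      simpa [vee, Finset.filter_singleton, chi_empty, veeOne,
        (stabilizes_iff_of_notMem hH hg (∅ : Finset (G ⧸ H))).2 (Or.inl rfl)] using h0
    rw [h2] at h1 ⊢
    rw [Pi.sub_apply]
    linear_combination h1

theorem isNorm_normFun [Finite G] [Fintype (G ⧸ H)] (hH : H.index.Prime) (σ τ : FDRep ℂ H) :
    IsNorm (σ.character - τ.character) (normFun (H := H) (σ.character - τ.character)) := by
  classical
  have key : ∃ b : G → Finset (G ⧸ H) → ℂ,
      ∀ g C, Stabilizes g C → vee (chi τ) b g C = veeOne g C := by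
    refine ⟨fun g C => if hg : g ∈ H then (-τ.character ⟨g, hg⟩) ^ C.card else
      if C = ∅ then 1 else -τ.character ⟨g ^ H.index, H.pow_index_mem g⟩, fun g C hC => ?_⟩
    by_cases hg : g ∈ H
    · rw [vee_chi_of_mem τ _ hg]
      simp only [hg, dif_pos]
      rw [sum_powerset_pow_card_mul_pow_card_sdiff C, add_neg_cancel, veeOne]
      split_ifs with h
      · simp [h]
      · rw [zero_pow (by simpa using h)]
    · obtain rfl | rfl := (stabilizes_iff_of_notMem hH hg C).1 hC
      · simp [vee, Finset.filter_singleton, chi_empty, veeOne, hC, hg]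
      · rw [vee_of_notMem hH _ _ hg, chi_empty, chi_univ_of_notMem hH _ hg, veeOne]
        simp [hg, Finset.univ_nonempty.ne_empty]
  obtain ⟨b, hb⟩ := key
  have h : IsNorm (σ.character - τ.character) (fun g => vee (chi σ) b g Finset.univ) :=
    ⟨σ, τ, b, rfl, hb, fun g => rfl⟩
  rwa [h.eq_normFun hH] at h

end NormFormula

/-! ### The norm and the powers of the augmentation ideal -/

section NormFiltration

variable {G : Type*} [CommGroup G] {H : Subgroup G}

theorem exists_linearCharacter_extension [Finite G] (χ : H →* ℂ) :
    ∃ ψ : G →* ℂ, ∀ h : H, ψ h = χ h := by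
  obtain ⟨ψ, hψ⟩ := MonoidHom.domRestrict_surjective (M := ℂ) H χ.toHomUnits
  refine ⟨(Units.coeHom ℂ).comp ψ, fun h => ?_⟩
  have := congrArg Units.val (DFunLike.congr_fun hψ h)
  simpa using this

variable (H) in
/-- Restriction of functions from `G` to `H`. -/
def restrictHom : (G → ℂ) →ₐ[ℤ] (H → ℂ) where
  toFun x := fun h => x h
  map_one' := rfl
  map_mul' _ _ := rfl
  map_zero' := rfl
  map_add' _ _ := rfl
  commutes' _ := rfl

/-- Restriction maps the powers of the augmentation ideal of `G` onto those of `H`, since linear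
characters extend from `H` to `G`. -/
theorem augmentationPower_le_map_restrictHom [Finite G] (n : ℕ) :
    augmentationPower H n ≤ (augmentationPower G n).map (restrictHom H).toLinearMap := by
  rw [augmentationPower, augmentationPower, Submodule.map_mul, Submodule.map_pow]
  have h1 : linearSpan H ≤ (linearSpan G).map (restrictHom H).toLinearMap := by
    rw [linearSpan, Submodule.span_le]
    rintro _ ⟨χ, rfl⟩
    obtain ⟨ψ, hψ⟩ := exists_linearCharacter_extension χ
    exact ⟨ψ, coe_mem_linearSpan ψ, funext hψ⟩
  have h2 : linearAugmentation H ≤ (linearAugmentation G).map (restrictHom H).toLinearMap := by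
    rw [linearAugmentation, Submodule.span_le]
    rintro _ ⟨χ, rfl⟩
    obtain ⟨ψ, hψ⟩ := exists_linearCharacter_extension χ
    refine ⟨ψ - 1, Submodule.subset_span ⟨ψ, rfl⟩, ?_⟩
    rw [map_sub]
    exact congrArg₂ _ (funext hψ) rfl
  exact mul_le_mul' h1 (pow_le_pow_left' h2 n)

variable (H) in
/-- The set of the linear characters of `G` that are trivial on `H`, for `H` of prime index `p`.
At an element outside `H` they take each `p`-th root of unity as a value exactly once. -/
theorem exists_linearCharacters_of_quotient [Finite G] (hH : H.index.Prime) :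
    ∃ s : Finset (G →* ℂ), s.card = H.index ∧ (∀ ε ∈ s, ∀ g ∈ H, ε g = 1) ∧
      ∀ g ∉ H, ∏ ε ∈ s, (Polynomial.X - Polynomial.C (ε g)) = Polynomial.X ^ H.index - 1 := by
  classical
  have := Fintype.ofFinite ((G ⧸ H) →* ℂˣ)
  have hcard : Fintype.card ((G ⧸ H) →* ℂˣ) = H.index := by
    rw [← Nat.card_eq_fintype_card, CommGroup.card_monoidHom_of_hasEnoughRootsOfUnity]
    rfl
  let F : ((G ⧸ H) →* ℂˣ) → (G →* ℂ) := fun ε =>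
    ((Units.coeHom ℂ).comp ε).comp (QuotientGroup.mk' H)
  have hinj {g : G} (hg : g ∉ H) : Function.Injective fun ε => F ε g := by
    intro ε ε' h
    have h' : ε g = ε' g := Units.ext h
    have := Fact.mk hH
    ext c
    obtain ⟨k, hk⟩ := mem_powers_of_prime_card (G := G ⧸ H) (p := H.index) rfl
      (g := (g : G ⧸ H)) (g' := c) (by rwa [Ne, QuotientGroup.eq_one_iff])
    simp only at hk
    change (ε (c : G ⧸ H) : ℂ) = ε' (c : G ⧸ H)
    rw [← hk, map_pow, map_pow, h']
  have hF : Function.Injective F := by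
    obtain ⟨g, hg⟩ : ∃ g, g ∉ H := by
      by_contra! h
      rw [(Subgroup.eq_top_iff' H).2 h, Subgroup.index_top] at hH
      exact Nat.not_prime_one hH
    exact fun ε ε' h => hinj hg (DFunLike.congr_fun h g)
  refine ⟨Finset.univ.image F, ?_, ?_, fun g hg => ?_⟩
  · rw [Finset.card_image_of_injective _ hF, Finset.card_univ, hcard]
  · intro ε hε g hg
    obtain ⟨ε, -, rfl⟩ := Finset.mem_image.1 hε
    simp [F, (QuotientGroup.eq_one_iff g).2 hg]
  · rw [Polynomial.X_pow_sub_one_eq_prod hH.pos (Complex.isPrimitiveRoot_exp _ hH.ne_zero),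
      Finset.prod_image hF.injOn,
      ← Finset.prod_image (f := fun z => Polynomial.X - Polynomial.C z) (hinj hg).injOn]
    congr 1
    refine Finset.eq_of_subset_of_card_le (fun z hz => ?_) ?_
    · obtain ⟨ε, -, rfl⟩ := Finset.mem_image.1 hz
      rw [Polynomial.mem_nthRootsFinset hH.pos, ← map_pow]
      simp [F, (QuotientGroup.eq_one_iff _).2 (H.pow_index_mem g)]
    · rw [Finset.card_image_of_injective _ (hinj hg), Finset.card_univ, hcard]
      exact (Multiset.toFinset_card_le _).trans (Polynomial.card_nthRoots _ _)

/-- The norm of `χ - 1` is the product of `ψ - ε`, where `ψ` extends `χ` and `ε` runs through the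
linear characters of `G ⧸ H`: off `H` this is the factorization of `X ^ p - 1`. -/
theorem normFun_sub_one_mem [Finite G] (hH : H.index.Prime) (χ : H →* ℂ) :
    normFun (H := H) ((χ : H → ℂ) - 1) ∈ augmentationPower G H.index := by
  obtain ⟨s, hs, hs1, hs2⟩ := exists_linearCharacters_of_quotient H hH
  obtain ⟨ψ, hψ⟩ := exists_linearCharacter_extension χ
  have h : normFun (H := H) ((χ : H → ℂ) - 1) = ∏ ε ∈ s, ((ψ : G → ℂ) - ε) := by
    funext g
    rw [Finset.prod_apply]
    by_cases hg : g ∈ H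
    · rw [normFun_of_mem _ hg, ← hs, ← Finset.prod_const]
      refine Finset.prod_congr rfl fun ε hε => ?_
      simp [hs1 ε hε g hg, ← hψ]
    · have h3 := congrArg (Polynomial.eval (ψ g)) (hs2 g hg)
      simp only [Polynomial.eval_prod, Polynomial.eval_sub, Polynomial.eval_X, Polynomial.eval_C,
        Polynomial.eval_pow, Polynomial.eval_one] at h3
      rw [normFun_of_notMem _ hg]
      simp only [Pi.sub_apply, Pi.one_apply, ← hψ, map_pow, h3]
  rw [h, ← hs, Finset.card_eq_sum_ones]
  refine prod_mem_augmentationPower s _ _ fun ε _ => ?_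
  rw [← sub_sub_sub_cancel_right _ _ 1]
  exact sub_mem (sub_one_mem_augmentationPower_one ψ) (sub_one_mem_augmentationPower_one ε)

theorem normFun_mul (x y : H → ℂ) : normFun (x * y) = normFun x * normFun y := by
  funext g
  by_cases hg : g ∈ H
  · simp [normFun_of_mem _ hg, mul_pow]
  · simp [normFun_of_notMem _ hg]

/-- The norm of `χ` is the linear character `ψ ^ p`, for `ψ` extending `χ`. -/
theorem normFun_coe_mem [Finite G] (χ : H →* ℂ) : normFun (χ : H → ℂ) ∈ augmentationPower G 0 := by
  obtain ⟨ψ, hψ⟩ := exists_linearCharacter_extension χ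
  rw [augmentationPower_zero]
  convert coe_mem_linearSpan (ψ ^ H.index) using 1
  funext g
  by_cases hg : g ∈ H
  · rw [normFun_of_mem _ hg, ← hψ]; rfl
  · rw [normFun_of_notMem _ hg, ← hψ, map_pow]; rfl

/-- The norm is additive up to a function induced from `H`: `N(x + y) - N(x) - N(y)` is `p` times
`q = ∑ 0 < i < p, (1 / p) (p choose i) xⁱ yᵖ⁻ⁱ` on `H` and vanishes off `H`, hence is the product of
an extension of `q` to `G` with the character `∑ ε` of `G ⧸ H`. -/
theorem exists_normFun_add_eq [Finite G] (hH : H.index.Prime) {n : ℕ} {x y : H → ℂ}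
    (hx : x ∈ augmentationPower H n) (hy : y ∈ augmentationPower H n) :
    ∃ w ∈ augmentationPower G (n * H.index), normFun (x + y) = normFun x + normFun y + w := by
  obtain ⟨s, hs, hs1, hs2⟩ := exists_linearCharacters_of_quotient H hH
  -- The quotient is one of natural numbers, exact as `p` divides `p.choose i` for `0 < i < p`.
  let q : H → ℂ := ∑ i ∈ Finset.Ioo 0 H.index,
    (H.index.choose i / H.index) • (x ^ i * y ^ (H.index - i))
  have hq : q ∈ augmentationPower H (n * H.index) := by
    refine Submodule.sum_mem _ fun i hi => Submodule.smul_of_tower_mem _ _ ?_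
    have hi' : n * H.index = n * i + n * (H.index - i) := by
      rw [← mul_add, Nat.add_sub_cancel' (Finset.mem_Ioo.1 hi).2.le]
    rw [hi']
    exact mul_mem_augmentationPower (pow_mem_augmentationPower hx _)
      (pow_mem_augmentationPower hy _)
  obtain ⟨z, hz, hzq⟩ := augmentationPower_le_map_restrictHom _ hq
  refine ⟨(∑ ε ∈ s, (ε : G → ℂ)) * z, ?_, ?_⟩
  · rw [← zero_add (n * H.index)]
    refine mul_mem_augmentationPower ?_ hz
    rw [augmentationPower_zero]
    exact Submodule.sum_mem _ fun ε _ => coe_mem_linearSpan ε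
  · funext g
    simp only [Pi.add_apply, Pi.mul_apply, Finset.sum_apply]
    by_cases hg : g ∈ H
    · have h1 : z g = q ⟨g, hg⟩ := congrFun hzq ⟨g, hg⟩
      rw [normFun_of_mem _ hg, normFun_of_mem _ hg, normFun_of_mem _ hg, h1,
        Finset.sum_congr rfl fun ε hε => hs1 ε hε g hg, Finset.sum_const, hs, Pi.add_apply, add_pow]
      have h2 : Finset.range (H.index + 1) = insert 0 (insert H.index (Finset.Ioo 0 H.index)) := by
        ext i
        have := hH.pos
        simp
        omega
      rw [h2, Finset.sum_insert (by simp [hH.ne_zero.symm]), Finset.sum_insert (by simp)]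
      simp only [q, Finset.sum_apply, nsmul_eq_mul, mul_one, Finset.mul_sum]
      rw [← add_assoc]
      congr 1
      · simp; ring
      · refine Finset.sum_congr rfl fun i hi => ?_
        rw [Finset.mem_Ioo] at hi
        have h3 : ((H.index.choose i : ℕ) : ℂ) =
            (H.index : ℂ) * ((H.index.choose i / H.index : ℕ) : ℂ) := by
          rw [← Nat.cast_mul, Nat.mul_div_cancel' (hH.dvd_choose_self hi.1.ne' hi.2)]
        simp [h3]
        ring
    · -- The sum of the `p`-th roots of unity is the coefficient of `X ^ (p - 1)` in `1 - X ^ p`.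
      have h3 : ∑ ε ∈ s, ε g = 0 := by
        rw [← neg_eq_zero, ← Polynomial.prod_X_sub_C_nextCoeff, hs2 g hg, ← Polynomial.C_1,
          Polynomial.nextCoeff_of_natDegree_pos
            (by rw [Polynomial.natDegree_X_pow_sub_C]; exact hH.pos),
          Polynomial.natDegree_X_pow_sub_C]
        have := hH.two_le
        rw [Polynomial.coeff_sub, Polynomial.coeff_X_pow, Polynomial.coeff_C, if_neg (by omega),
          if_neg (by omega), sub_zero]
      rw [normFun_of_notMem _ hg, normFun_of_notMem _ hg, normFun_of_notMem _ hg, h3]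
      simp

open scoped Pointwise in
theorem normFun_mem [Finite G] (hH : H.index.Prime) {n : ℕ} {x : H → ℂ}
    (hx : x ∈ augmentationPower H n) : normFun x ∈ augmentationPower G (n * H.index) := by
  have hzero : normFun (0 : H → ℂ) = 0 := by
    funext g
    by_cases hg : g ∈ H
    · simp [normFun_of_mem _ hg, hH.ne_zero]
    · simp [normFun_of_notMem _ hg]
  have hx' := hx
  rw [augmentationPower_eq_span, ← Submodule.mem_toAddSubgroup,
    Submodule.span_int_eq_addSubgroupClosure] at hx'
  have hle : ∀ y ∈ AddSubgroup.closure ((Set.range fun χ : H →* ℂ => (χ : H → ℂ)) *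
      (Set.range fun χ : H →* ℂ => (χ : H → ℂ) - 1) ^ n), y ∈ augmentationPower H n := by
    intro y hy
    rwa [augmentationPower_eq_span, ← Submodule.mem_toAddSubgroup,
      Submodule.span_int_eq_addSubgroupClosure]
  clear hx
  induction hx' using AddSubgroup.closure_induction with
  | mem x hx =>
    obtain ⟨_, ⟨χ, rfl⟩, y, hy, rfl⟩ := hx
    have hpow : ∀ k, ∀ y ∈ (Set.range fun χ : H →* ℂ => (χ : H → ℂ) - 1) ^ k,
        normFun y ∈ augmentationPower G (k * H.index) := by
      intro k
      induction k with
      | zero =>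
        intro y hy
        rw [pow_zero, Set.mem_one] at hy
        rw [hy, zero_mul]
        exact normFun_coe_mem (1 : H →* ℂ)
      | succ k ih =>
        intro y hy
        rw [pow_succ] at hy
        obtain ⟨u, hu, _, ⟨ψ, rfl⟩, rfl⟩ := hy
        change normFun (u * ((ψ : H → ℂ) - 1)) ∈ _
        rw [normFun_mul, Nat.succ_mul]
        exact mul_mem_augmentationPower (ih u hu) (normFun_sub_one_mem hH ψ)
    change normFun ((χ : H → ℂ) * y) ∈ _
    rw [normFun_mul, ← zero_add (n * H.index)]
    exact mul_mem_augmentationPower (normFun_coe_mem χ) (hpow n y hy)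
  | zero => rw [hzero]; exact zero_mem _
  | add x y hx hy hx' hy' =>
    obtain ⟨w, hw, h⟩ := exists_normFun_add_eq hH (hle x hx) (hle y hy)
    rw [h]
    exact add_mem (add_mem hx' hy') hw
  | neg x hx hx' =>
    -- Apply the formula for `N(x + y)` to `y = -x`, where `N(x + y) = 0`.
    obtain ⟨w, hw, h⟩ := exists_normFun_add_eq hH (hle x hx) (neg_mem (hle x hx))
    rw [add_neg_cancel, hzero] at h
    have : normFun (-x) = -normFun x - w := by linear_combination -h
    rw [this]
    exact sub_mem (neg_mem hx') hw

theorem exists_eq_character_sub_character {A : Type*} [CommGroup A] {x : A → ℂ}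
    (hx : x ∈ linearSpan A) : ∃ V W : FDRep ℂ A, x = V.character - W.character := by
  have key : ∃ (d e : ℕ) (χ : Fin d → A →* ℂ) (ψ : Fin e → A →* ℂ),
      x = ∑ i, (χ i : A → ℂ) - ∑ j, (ψ j : A → ℂ) := by
    rw [linearSpan, ← Submodule.mem_toAddSubgroup, Submodule.span_int_eq_addSubgroupClosure] at hx
    induction hx using AddSubgroup.closure_induction with
    | mem x hx =>
      obtain ⟨χ, rfl⟩ := hx
      exact ⟨1, 0, fun _ => χ, Fin.elim0, by simp⟩
    | zero => exact ⟨0, 0, Fin.elim0, Fin.elim0, by simp⟩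
    | add x y _ _ hx hy =>
      obtain ⟨d, e, χ, ψ, rfl⟩ := hx
      obtain ⟨d', e', χ', ψ', rfl⟩ := hy
      refine ⟨d + d', e + e', Fin.append χ χ', Fin.append ψ ψ', ?_⟩
      simp only [Fin.sum_univ_add, Fin.append_left, Fin.append_right]
      ring
    | neg x _ hx =>
      obtain ⟨d, e, χ, ψ, rfl⟩ := hx
      exact ⟨e, d, ψ, χ, by simp⟩
  obtain ⟨d, e, χ, ψ, rfl⟩ := key
  obtain ⟨V, b, hb⟩ := exists_isEigenbasis_of_linearCharacters χ
  obtain ⟨W, c, hc⟩ := exists_isEigenbasis_of_linearCharacters ψ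
  exact ⟨V, W, by rw [hb.character_eq, hc.character_eq]⟩

end NormFiltration

end VirtualCharacter

theorem mainTheorem2 {G : Type*} [CommGroup G] [Finite G] (H : Subgroup G) [Fintype (G ⧸ H)]
    (p : ℕ) (hp : p.Prime) (hindex : H.index = p) (n : ℕ)
    (x : H → ℂ) (hx : x ∈ VirtualCharacter.gammaFiltration H n) :
    ∃ y ∈ VirtualCharacter.gammaFiltration G (n * p),
      ∀ z : G → ℂ, VirtualCharacter.IsNorm x z ↔ z = y := by
  subst hindex
  have hx' := VirtualCharacter.gammaFiltration_le_augmentationPower n hx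
  refine ⟨VirtualCharacter.normFun x, VirtualCharacter.augmentationPower_le_gammaFiltration _
    (VirtualCharacter.normFun_mem hp hx'), fun z => ⟨fun h => h.eq_normFun hp, ?_⟩⟩
  rintro rfl
  have hx0 : x ∈ VirtualCharacter.linearSpan H := by
    rw [← VirtualCharacter.augmentationPower_zero]
    exact VirtualCharacter.augmentationPower_antitone (Nat.zero_le n) hx'
  obtain ⟨σ, τ, rfl⟩ := VirtualCharacter.exists_eq_character_sub_character hx0
  exact VirtualCharacter.isNorm_normFun hp σ τ
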